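/- A convex domain is a compact convex set $K\subset\mathbb{E}^2$ with nonempty interior. It is smooth if through every point of its boundary there passes exactly one line supporting $K$, and strictly convex if its boundary contains no nontrivial line segment. A packing of translates of $K$ is a family of translates with pairwise disjoint interiors; two of its members touch if they have a common point. The packing is totally separable if any two of its members are separated by a line that is disjoint from the interior of every member. The contact number of a finite packing is the number of unordered pairs of distinct members that touch. (A) Let $K$ be a smooth convex domain. The maximum number of translates of $K$ that all touch $K$ and, together with $K$, form a totally separable packing (the separable Hadwiger number $H_{\rm sep}(K)$) is equal to $4$. (B) Let $K$ be a smooth strictly convex domain and $n\ge 2$ an integer. The maximum contact number of a totally separable packing of $n$ translates of $K$ (the maximum separable contact number $c_{\rm sep}(K,n,2)$) is equal to $\left\lfloor 2n-2\sqrt{n}\right\rfloor$. -/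

import Mathlib

/-- The Euclidean plane. -/
abbrev Plane : Type := EuclideanSpace ℝ (Fin 2)

/-- A convex domain: a compact convex subset of the plane with nonempty interior. -/
structure IsConvexDomain (K : Set Plane) : Prop where
  convex : Convex ℝ K
  isCompact : IsCompact K
  interior_nonempty : (interior K).Nonempty

/-- `H` is a line through `p` that supports `K`: it is the level line `f = c` of a nonzero linear
functional `f`, and `K` lies in the closed half-plane `f ≤ c`. -/
def IsSupportingLineAt (K H : Set Plane) (p : Plane) : Prop :=
  p ∈ H ∧ ∃ f : Plane →L[ℝ] ℝ, f ≠ 0 ∧ ∃ c : ℝ, H = {x | f x = c} ∧ ∀ x ∈ K, f x ≤ c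

/-- `K` is smooth: every boundary point lies on exactly one supporting line of `K`. -/
def IsSmoothDomain (K : Set Plane) : Prop :=
  ∀ p ∈ frontier K, ∃! H : Set Plane, IsSupportingLineAt K H p

/-- The translate `x + K`. -/
def translateBy (x : Plane) (K : Set Plane) : Set Plane :=
  (fun p => x + p) '' K

/-- Two sets are non-overlapping if their interiors are disjoint. -/
def NonOverlapping (A B : Set Plane) : Prop :=
  Disjoint (interior A) (interior B)

/-- Two sets touch if they meet but do not overlap. -/
def Touches (A B : Set Plane) : Prop :=
  NonOverlapping A B ∧ (A ∩ B).Nonempty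

theorem Touches.symm {A B : Set Plane} (h : Touches A B) : Touches B A :=
  ⟨Disjoint.symm h.1, Set.inter_comm A B ▸ h.2⟩

/-- The translates `x + K`, `x ∈ X`, form a packing. -/
def IsPacking (K : Set Plane) (X : Set Plane) : Prop :=
  X.Pairwise fun x y => NonOverlapping (translateBy x K) (translateBy y K)

/-- The line `f = c` separates `A` and `B`, with `A` and `B` in opposite closed half-planes. -/
def Separates (f : Plane →L[ℝ] ℝ) (c : ℝ) (A B : Set Plane) : Prop :=
  (∀ p ∈ A, f p ≤ c) ∧ (∀ p ∈ B, c ≤ f p)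

/-- The translates `x + K`, `x ∈ X`, form a totally separable packing: any two of them are separated
by a line that is disjoint from the interior of every one of them. -/
def IsTotallySeparablePacking (K : Set Plane) (X : Set Plane) : Prop :=
  IsPacking K X ∧
    X.Pairwise fun x y => ∃ f : Plane →L[ℝ] ℝ, f ≠ 0 ∧ ∃ c : ℝ,
      Separates f c (translateBy x K) (translateBy y K) ∧
        ∀ z ∈ X, Disjoint {p | f p = c} (interior (translateBy z K))

/-- The possible numbers of translates of `K` that all touch `K` and, together with `K`, form a
totally separable packing. The separable Hadwiger number of `K` is the maximum of this set. -/
def separableHadwigerValues (K : Set Plane) : Set ℕ∞ :=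
  {m | ∃ X : Set Plane, (∀ x ∈ X, Touches (translateBy x K) K) ∧
    IsTotallySeparablePacking K (insert 0 X) ∧ X.encard = m}

/-- The contact graph of the translates `x + K`, `x ∈ X`. -/
def contactGraph (K : Set Plane) (X : Set Plane) : SimpleGraph X where
  Adj x y := x ≠ y ∧ Touches (translateBy x K) (translateBy y K)
  symm := ⟨fun _ _ h => ⟨h.1.symm, h.2.symm⟩⟩
  loopless := ⟨fun _ h => h.1 rfl⟩

/-- The contact numbers (numbers of edges of the contact graph) of the totally separable packings of
`n` translates of `K`. The maximum separable contact number is the maximum of this set. -/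
def separableContactValues (K : Set Plane) (n : ℕ) : Set ℕ :=
  {c | ∃ X : Finset Plane, X.card = n ∧ IsTotallySeparablePacking K (X : Set Plane) ∧
    (contactGraph K (X : Set Plane)).edgeSet.ncard = c}

/-! Two translates `x + K`, `y + K` of a packing touch exactly when `y - x` lies on the unit sphere
of the norm with unit ball `K - K`. An Auerbach basis `a, b` of this norm with dual basis `f, g`
puts `K` in strips of `f`- and `g`-width 1. Translates of `K` by points of the lattice of `a, b`
thus form a totally separable packing, in which lattice neighbours touch. This gives both lower
bounds: four neighbours of the origin, and a nearly square grid of `n` points.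

For the upper bounds, a line separating touching members `x`, `y` comes from a functional `F`
supporting `K - K` at `y - x`, and smoothness forces `F (z - x) ≤ 0` for every other member `z`
touching `x` (`exists_contact_functional`). The plane admits at most four vectors with such
functionals, whence (A).

For (B), the half-open quadrant `f > 0, g ≥ 0` and its quarter turns partition the nonzero vectors.
With strict convexity, a functional supporting `K - K` at a point of this quadrant is positive on
the whole quadrant (`supports_pos`), so a member has at most one contact in each quadrant. Up to
orientation the contacts are therefore two relations `R`, `S` whose components are paths.
Monotonicity of `f` and `g` along paths makes an `R`-path and an `S`-path share at most one member.
With `A` and `B` paths, `n ≤ A * B`, and there are at most `2n - A - B ≤ 2n - 2√n` contacts. -/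

/-! ### Supporting functionals of the difference body -/

/-- The functional `f` supports the difference body `K - K` at its point `u`. -/
structure SupportsDifferenceAt (K : Set Plane) (f : Plane →L[ℝ] ℝ) (u : Plane) : Prop where
  mem : ∃ p ∈ K, ∃ q ∈ K, u = p - q
  ne_zero : f ≠ 0
  le : ∀ p ∈ K, ∀ q ∈ K, f p - f q ≤ f u

theorem lt_of_mem_interior {S : Set Plane} {f : Plane →L[ℝ] ℝ} (hf : f ≠ 0) {c : ℝ}
    (h : ∀ p ∈ S, f p ≤ c) {p : Plane} (hp : p ∈ interior S) : f p < c := by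
  have hne : ∃ v, 0 < f v := by
    by_contra! hcon
    apply hf
    ext v
    have h1 := hcon v
    have h2 := hcon (-v)
    rw [map_neg] at h2
    simp only [zero_apply]
    linarith
  obtain ⟨v, hv⟩ := hne
  have hcont : Filter.Tendsto (fun t : ℝ => p + t • v) (nhdsWithin 0 (Set.Ioi 0)) (nhds p) := by
    have : Continuous (fun t : ℝ => p + t • v) := by fun_prop
    have h2 := this.tendsto 0
    simp only [zero_smul, add_zero] at h2
    exact h2.mono_left nhdsWithin_le_nhds
  have h1 := hcont.eventually (mem_interior_iff_mem_nhds.1 hp)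
  obtain ⟨t, ht, ht0⟩ := (h1.and self_mem_nhdsWithin).exists
  have h3 := h _ ht
  simp only [map_add, map_smul, smul_eq_mul] at h3
  have h4 : 0 < t * f v := mul_pos ht0 hv
  linarith

theorem gt_of_mem_interior {S : Set Plane} {f : Plane →L[ℝ] ℝ} (hf : f ≠ 0) {c : ℝ}
    (h : ∀ p ∈ S, c ≤ f p) {p : Plane} (hp : p ∈ interior S) : c < f p := by
  have h1 := lt_of_mem_interior (f := -f) (neg_ne_zero.2 hf) (c := -c) (S := S)
    (fun q hq => by simpa using h q hq) hp
  simpa using h1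

theorem SupportsDifferenceAt.pos {K : Set Plane} (hK : IsConvexDomain K) {f : Plane →L[ℝ] ℝ}
    {u : Plane} (h : SupportsDifferenceAt K f u) : 0 < f u := by
  obtain ⟨p, hp⟩ := hK.interior_nonempty
  by_contra! hu
  have h1 : ∀ q ∈ K, f q ≤ f p := fun q hq => by
    have := h.le q hq p (interior_subset hp)
    linarith
  exact lt_irrefl _ (lt_of_mem_interior h.ne_zero h1 hp)

/-- If `u = p - q`, both functionals attain their maximum over `K` at `p`, and smoothness allows
only one supporting line there. Cross-multiplication avoids naming the factor. -/
theorem SupportsDifferenceAt.proportional {K : Set Plane} (hs : IsSmoothDomain K)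
    {f g : Plane →L[ℝ] ℝ} {u : Plane}
    (hf : SupportsDifferenceAt K f u) (hg : SupportsDifferenceAt K g u) (v : Plane) :
    f v * g u = g v * f u := by
  obtain ⟨p, hp, q, hq, rfl⟩ := hf.mem
  have hfp : ∀ x ∈ K, f x ≤ f p := fun x hx => by
    have := hf.le x hx q hq
    rw [map_sub] at this
    linarith
  have hgp : ∀ x ∈ K, g x ≤ g p := fun x hx => by
    have := hg.le x hx q hq
    rw [map_sub] at this
    linarith
  have hfr : p ∈ frontier K := by
    refine ⟨subset_closure hp, fun hi => ?_⟩
    exact lt_irrefl _ (lt_of_mem_interior hf.ne_zero hfp hi)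
  have heq : {x | f x = f p} = {x | g x = g p} :=
    (hs p hfr).unique ⟨rfl, f, hf.ne_zero, f p, rfl, hfp⟩ ⟨rfl, g, hg.ne_zero, g p, rfl, hgp⟩
  -- The added vector lies in the kernel of `f`, so the point stays on the common line; reading this
  -- through `g` is the claim.
  have hw : p + (f (p - q) • v - f v • (p - q)) ∈ {x | f x = f p} := by
    simp only [Set.mem_ofPred_eq, map_add, map_sub, map_smul, smul_eq_mul]
    ring
  rw [heq] at hw
  simp only [Set.mem_ofPred_eq, map_add, map_sub, map_smul, smul_eq_mul] at hw ⊢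
  linarith

/-! ### Translates, separating lines and contacts -/

theorem mem_translateBy_add {K : Set Plane} (x : Plane) {p : Plane} (hp : p ∈ K) :
    x + p ∈ translateBy x K :=
  ⟨p, hp, rfl⟩

theorem translateBy_zero (K : Set Plane) : translateBy 0 K = K := by
  simp [translateBy]

theorem translateBy_closure_interior {K : Set Plane} (hK : IsConvexDomain K) (x : Plane) :
    translateBy x K ⊆ closure (interior (translateBy x K)) := by
  have hc : Convex ℝ (translateBy x K) := hK.convex.translate x
  have hne : (interior (translateBy x K)).Nonempty := by
    obtain ⟨p, hp⟩ := hK.interior_nonempty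
    refine ⟨x + p, ?_⟩
    have : interior (translateBy x K) = (fun p => x + p) '' interior K :=
      ((Homeomorph.addLeft x).image_interior K).symm
    rw [this]
    exact ⟨p, hp, rfl⟩
  rw [hc.closure_interior_eq_closure_of_nonempty_interior hne]
  exact subset_closure

/-- The image of the convex interior under `f` is an interval missing `c`; the weak inequality
passes to the closure, which contains the translate. -/
theorem one_side_of_disjoint_interior {K : Set Plane} (hK : IsConvexDomain K) (z : Plane)
    {f : Plane →L[ℝ] ℝ} {c : ℝ} (h : Disjoint {p | f p = c} (interior (translateBy z K))) :
    (∀ p ∈ K, f z + f p ≤ c) ∨ (∀ p ∈ K, c ≤ f z + f p) := by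
  have hcl := translateBy_closure_interior hK z
  have hc : Convex ℝ (interior (translateBy z K)) := (hK.convex.translate z).interior
  have hpre : IsPreconnected (f '' interior (translateBy z K)) :=
    hc.isPreconnected.image f f.continuous.continuousOn
  have hnot : c ∉ f '' interior (translateBy z K) := by
    rintro ⟨p, hp, hpc⟩
    exact Set.disjoint_left.1 h hpc hp
  have hcase : (∀ p ∈ interior (translateBy z K), f p ≤ c) ∨
      (∀ p ∈ interior (translateBy z K), c ≤ f p) := by
    by_contra! hcon
    obtain ⟨⟨p, hp, hpc⟩, q, hq, hqc⟩ := hcon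
    exact hnot (hpre.ordConnected.out ⟨q, hq, rfl⟩ ⟨p, hp, rfl⟩ ⟨hqc.le, hpc.le⟩)
  rcases hcase with h1 | h1
  · left
    intro p hp
    have h2 : closure (interior (translateBy z K)) ⊆ {p | f p ≤ c} :=
      closure_minimal h1 (isClosed_le f.continuous continuous_const)
    simpa using h2 (hcl (mem_translateBy_add z hp))
  · right
    intro p hp
    have h2 : closure (interior (translateBy z K)) ⊆ {p | c ≤ f p} :=
      closure_minimal h1 (isClosed_le continuous_const f.continuous)
    simpa using h2 (hcl (mem_translateBy_add z hp))

theorem exists_sub_eq_of_touches {K : Set Plane} {x y : Plane}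
    (h : Touches (translateBy x K) (translateBy y K)) : ∃ p ∈ K, ∃ q ∈ K, y - x = p - q := by
  obtain ⟨_, ⟨p, hp, rfl⟩, ⟨q, hq, he⟩⟩ := h.2
  refine ⟨p, hp, q, hq, ?_⟩
  simp only at he
  rw [sub_eq_sub_iff_add_eq_add, he, add_comm]

theorem not_touches_self {K : Set Plane} (hK : IsConvexDomain K) (x : Plane) :
    ¬ Touches (translateBy x K) (translateBy x K) := by
  rintro ⟨h, -⟩
  rw [NonOverlapping, disjoint_self, Set.bot_eq_empty] at h
  have h1 := translateBy_closure_interior hK x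
  rw [h, closure_empty] at h1
  obtain ⟨p, hp⟩ := hK.interior_nonempty
  exact h1 (mem_translateBy_add x (interior_subset hp))

/-- Two distinct members of a totally separable packing are separated by a functional that puts
every member on one side. -/
theorem IsTotallySeparablePacking.exists_separating {K X : Set Plane} (hK : IsConvexDomain K)
    (hX : IsTotallySeparablePacking K X) {x y : Plane} (hx : x ∈ X) (hy : y ∈ X) (hxy : x ≠ y) :
    ∃ f : Plane →L[ℝ] ℝ, f ≠ 0 ∧ ∃ c : ℝ, (∀ p ∈ K, f x + f p ≤ c) ∧ (∀ p ∈ K, c ≤ f y + f p) ∧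
      ∀ z ∈ X, (∀ p ∈ K, f z + f p ≤ c) ∨ (∀ p ∈ K, c ≤ f z + f p) := by
  obtain ⟨f, hf, c, ⟨h1, h2⟩, h3⟩ := hX.2 hx hy hxy
  refine ⟨f, hf, c, fun p hp => ?_, fun p hp => ?_, fun z hz =>
    one_side_of_disjoint_interior hK z (h3 z hz)⟩
  · simpa using h1 _ (mem_translateBy_add x hp)
  · simpa using h2 _ (mem_translateBy_add y hp)

/-- The functional of a contact: any other member touching `x + K` lies in its nonpositive
half-plane relative to `x`. -/
theorem IsTotallySeparablePacking.exists_contact_functional {K X : Set Plane}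
    (hK : IsConvexDomain K) (hs : IsSmoothDomain K) (hX : IsTotallySeparablePacking K X)
    {x y : Plane} (hx : x ∈ X) (hy : y ∈ X) (ht : Touches (translateBy x K) (translateBy y K)) :
    ∃ f : Plane →L[ℝ] ℝ, SupportsDifferenceAt K f (y - x) ∧
      ∀ z ∈ X, z ≠ y → Touches (translateBy x K) (translateBy z K) → f (z - x) ≤ 0 := by
  have hxy : x ≠ y := by
    rintro rfl
    exact not_touches_self hK x ht
  obtain ⟨f, hf, c, h1, h2, h3⟩ := hX.exists_separating hK hx hy hxy
  have hmem := exists_sub_eq_of_touches ht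
  have hsupp : SupportsDifferenceAt K f (y - x) := by
    refine ⟨hmem, hf, fun p hp q hq => ?_⟩
    have := h1 p hp
    have := h2 q hq
    rw [map_sub]
    linarith
  refine ⟨f, hsupp, fun z hz hzy htz => ?_⟩
  -- The contact point `x + k = y + l` lies on the separating line, which fixes `c`.
  obtain ⟨k, hk, l, hl, hkl⟩ := hmem
  have hkl' := congrArg f hkl
  simp only [map_sub] at hkl'
  have hmz := exists_sub_eq_of_touches htz
  rcases h3 z hz with h | h
  · have := h k hk
    have := h2 l hl
    rw [map_sub]
    linarith
  -- If `z` is on the side of `y`, then `f` supports `K - K` at both `y - x` and `z - x`. A line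
  -- separating `y` from `z` has `x` on one side, so its functional, up to sign, supports at one of
  -- these points and is proportional to `f`. But `f` vanishes on `z - y` and that functional does
  -- not.
  · have hge : f (y - x) ≤ f (z - x) := by
      have := h l hl
      have := h1 k hk
      simp only [map_sub]
      linarith
    have heq : f (z - x) = f (y - x) := by
      refine le_antisymm ?_ hge
      obtain ⟨p, hp, q, hq, hpq⟩ := hmz
      rw [hpq, map_sub]
      exact hsupp.le p hp q hq
    have hsz : SupportsDifferenceAt K f (z - x) :=
      ⟨hmz, hf, fun p hp q hq => heq ▸ hsupp.le p hp q hq⟩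
    obtain ⟨g, hg, d, g1, g2, g3⟩ := hX.exists_separating hK hy hz hzy.symm
    have hgpos : 0 < g (z - y) := by
      obtain ⟨p, hp⟩ := hK.interior_nonempty
      have a1 := lt_of_mem_interior hg (c := d - g y)
        (fun q hq => by have := g1 q hq; linarith) hp
      have a2 := g2 p (interior_subset hp)
      rw [map_sub]
      linarith
    have hfzy : f (z - y) = 0 := by
      have : z - y = (z - x) - (y - x) := by abel
      rw [this, map_sub, heq, sub_self]
    exfalso
    rcases g3 x hx with h | h
    · have hgs : SupportsDifferenceAt K g (z - x) := by
        refine ⟨hmz, hg, fun p hp q hq => ?_⟩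
        have := h p hp
        have := g2 q hq
        rw [map_sub]
        linarith
      have := hsz.proportional hs hgs (z - y)
      rw [hfzy, zero_mul] at this
      exact (mul_pos hgpos (hsz.pos hK)).ne this
    · have hgs : SupportsDifferenceAt K (-g) (y - x) := by
        refine ⟨⟨k, hk, l, hl, hkl⟩, neg_ne_zero.2 hg, fun p hp q hq => ?_⟩
        have := h q hq
        have := g1 p hp
        have h5 := h p hp
        have h6 := g1 q hq
        simp only [neg_apply, map_sub]
        linarith
      have := hsupp.proportional hs hgs (z - y)
      rw [hfzy, zero_mul, neg_apply] at this
      have := mul_pos hgpos (hsupp.pos hK)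
      linarith

/-! ### Auerbach bases -/

/-- An Auerbach basis of the norm with unit ball `K - K`, with its dual basis. -/
structure IsAuerbachBasis (K : Set Plane) (a b : Plane) (f g : Plane →L[ℝ] ℝ) : Prop where
  left_mem : ∃ p ∈ K, ∃ q ∈ K, a = p - q
  right_mem : ∃ p ∈ K, ∃ q ∈ K, b = p - q
  left_left : f a = 1
  left_right : f b = 0
  right_left : g a = 0
  right_right : g b = 1
  left_le : ∀ p ∈ K, ∀ q ∈ K, f p - f q ≤ 1
  right_le : ∀ p ∈ K, ∀ q ∈ K, g p - g q ≤ 1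
  decomp : ∀ v, v = f v • a + g v • b

namespace IsAuerbachBasis

-- The quarter turn below transfers facts from one quadrant to the next; applied twice, it negates
-- the basis.
variable {K : Set Plane} {a b : Plane} {f g : Plane →L[ℝ] ℝ}

theorem rotate (h : IsAuerbachBasis K a b f g) : IsAuerbachBasis K b (-a) g (-f) where
  left_mem := h.right_mem
  right_mem := by
    obtain ⟨p, hp, q, hq, he⟩ := h.left_mem
    exact ⟨q, hq, p, hp, by rw [he, neg_sub]⟩
  left_left := h.right_right
  left_right := by simp [h.right_left]
  right_left := by simp [h.left_right]
  right_right := by simp [h.left_left]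
  left_le := h.right_le
  right_le p hp q hq := by
    have := h.left_le q hq p hp
    simp only [neg_apply]
    linarith
  decomp v := by
    have := h.decomp v
    simp only [neg_apply, neg_smul, smul_neg, neg_neg]
    rw [add_comm]
    exact this

theorem left_supports (h : IsAuerbachBasis K a b f g) : SupportsDifferenceAt K f a where
  mem := h.left_mem
  ne_zero := by
    rintro rfl
    simpa using h.left_left
  le := by
    rw [h.left_left]
    exact h.left_le

theorem right_supports (h : IsAuerbachBasis K a b f g) : SupportsDifferenceAt K g b :=
  h.rotate.left_supports

end IsAuerbachBasis

/-- The functional `v ↦ det (v, b)`. -/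
noncomputable def detLeft (b : Plane) : Plane →L[ℝ] ℝ :=
  b 1 • EuclideanSpace.proj (0 : Fin 2) - b 0 • EuclideanSpace.proj (1 : Fin 2)

theorem detLeft_apply (v b : Plane) : detLeft b v = v 0 * b 1 - v 1 * b 0 := by
  simp [detLeft, mul_comm]

/-- Choose `a, b` in `K - K` of maximal determinant. Replacing one of them cannot increase it, which
bounds the coordinate functionals by 1. -/
theorem exists_isAuerbachBasis {K : Set Plane} (hK : IsConvexDomain K) :
    ∃ a b f g, IsAuerbachBasis K a b f g := by
  obtain ⟨p₀, hp₀⟩ := hK.interior_nonempty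
  let F : (Plane × Plane) × (Plane × Plane) → ℝ := fun z => detLeft (z.2.1 - z.2.2) (z.1.1 - z.1.2)
  have hF : Continuous F := by
    simp only [F, detLeft_apply, PiLp.sub_apply]
    fun_prop
  have hcomp : IsCompact ((K ×ˢ K) ×ˢ (K ×ˢ K)) :=
    (hK.isCompact.prod hK.isCompact).prod (hK.isCompact.prod hK.isCompact)
  have hm := interior_subset hp₀
  obtain ⟨⟨⟨p, q⟩, ⟨r, s⟩⟩, ⟨⟨hp, hq⟩, hr, hs⟩, hmax⟩ :=
    hcomp.exists_isMaxOn ⟨((p₀, p₀), (p₀, p₀)), ⟨hm, hm⟩, hm, hm⟩ hF.continuousOn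
  simp only at hp hq hr hs
  have hmax' : ∀ p' ∈ K, ∀ q' ∈ K, ∀ r' ∈ K, ∀ s' ∈ K,
      detLeft (r' - s') (p' - q') ≤ detLeft (r - s) (p - q) := fun p' h1 q' h2 r' h3 s' h4 =>
    hmax (show ((p', q'), (r', s')) ∈ (K ×ˢ K) ×ˢ (K ×ˢ K) from ⟨⟨h1, h2⟩, h3, h4⟩)
  have hsmall : ∀ v : Plane, ∃ t : ℝ, 0 < t ∧ p₀ + t • v ∈ K := fun v => by
    have hcont : Filter.Tendsto (fun t : ℝ => p₀ + t • v) (nhdsWithin 0 (Set.Ioi 0)) (nhds p₀) := by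
      have : Continuous (fun t : ℝ => p₀ + t • v) := by fun_prop
      have h2 := this.tendsto 0
      simp only [zero_smul, add_zero] at h2
      exact h2.mono_left nhdsWithin_le_nhds
    have h1 := hcont.eventually (mem_interior_iff_mem_nhds.1 hp₀)
    obtain ⟨t, ht, ht0⟩ := (h1.and self_mem_nhdsWithin).exists
    exact ⟨t, ht0, ht⟩
  set a := p - q with ha
  set b := r - s with hb
  have hpos : 0 < detLeft b a := by
    obtain ⟨t, ht, htK⟩ := hsmall !₂[1, 0]
    obtain ⟨t', ht', htK'⟩ := hsmall !₂[0, 1]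
    have := hmax' _ htK _ hm _ htK' _ hm
    refine lt_of_lt_of_le ?_ this
    simp only [add_sub_cancel_left, detLeft_apply]
    simp
    positivity
  have hswap : ∀ u v : Plane, detLeft u v = - detLeft v u := fun u v => by
    simp only [detLeft_apply]
    ring
  have hself : ∀ u : Plane, detLeft u u = 0 := fun u => by
    simp only [detLeft_apply]
    ring
  -- Cramer's rule: `f = det (·, b) / det (a, b)` and `g = det (a, ·) / det (a, b)`.
  refine ⟨a, b, (detLeft b a)⁻¹ • detLeft b, (- (detLeft b a)⁻¹) • detLeft a,
    ⟨p, hp, q, hq, rfl⟩, ⟨r, hr, s, hs, rfl⟩, ?_, ?_, ?_, ?_, ?_, ?_, ?_⟩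
  · simp [hpos.ne']
  · simp [hself]
  · simp [hself]
  · simp [hswap a b, hpos.ne']
  · intro p' hp' q' hq'
    rw [← map_sub]
    simp only [smul_apply, smul_eq_mul]
    rw [inv_mul_le_one₀ hpos]
    exact hmax' p' hp' q' hq' r hr s hs
  · intro p' hp' q' hq'
    rw [← map_sub]
    simp only [smul_apply, smul_eq_mul, neg_mul, ← mul_neg]
    rw [inv_mul_le_one₀ hpos, ← hswap]
    exact hmax' p hp q hq p' hp' q' hq'
  · intro v
    have hv : detLeft b a • v = detLeft b v • a + (- detLeft a v) • b := by
      ext i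
      fin_cases i <;> simp [detLeft_apply] <;> ring
    have h2 : v = (detLeft b a)⁻¹ • (detLeft b a • v) := by
      rw [smul_smul, inv_mul_cancel₀ hpos.ne', one_smul]
    conv_lhs => rw [h2, hv]
    simp only [smul_apply, smul_eq_mul, smul_add, smul_smul, neg_mul, mul_neg]

/-! ### Counting edges by two families of monotone paths -/

theorem exists_reflTransGen_terminal {V : Type*} [Finite V] {R : V → V → Prop} {φ : V → ℝ}
    (h : ∀ x y, R x y → φ x < φ y) (x : V) :
    ∃ e, Relation.ReflTransGen R x e ∧ ∀ y, ¬ R e y := by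
  obtain ⟨e, he, hmax⟩ := Set.exists_max_image {e | Relation.ReflTransGen R x e} φ
    (Set.toFinite _) ⟨x, Relation.ReflTransGen.refl⟩
  exact ⟨e, he, fun y hy => absurd (h e y hy) (not_lt.2 (hmax y (he.tail hy)))⟩

/-- Predecessors are unique, so walking back from `e` traces a single chain. -/
theorem reflTransGen_or_of_common_terminal {V : Type*} {R : V → V → Prop}
    (hl : ∀ x y z, R x z → R y z → x = y) {x y e : V} (hx : Relation.ReflTransGen R x e)
    (hy : Relation.ReflTransGen R y e) :
    Relation.ReflTransGen R x y ∨ Relation.ReflTransGen R y x := by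
  have := Relation.ReflTransGen.total_of_right_unique (r := Function.swap R)
    (fun _ _ _ h1 h2 => hl _ _ _ h1 h2) (Relation.reflTransGen_swap.2 hx)
    (Relation.reflTransGen_swap.2 hy)
  exact (this.imp Relation.reflTransGen_swap.1 Relation.reflTransGen_swap.1).symm

/-- The pair of terminals determines the vertex: two vertices with the same pair are comparable
along both an `R`-path and an `S`-path, and the monotonicities of `φ` and `ψ` contradict each other.
-/
theorem card_le_mul_card_terminal {V : Type*} [Fintype V] {R S : V → V → Prop} {φ ψ : V → ℝ}
    [DecidablePred fun x => ∀ y, ¬ R x y] [DecidablePred fun x => ∀ y, ¬ S x y]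
    (hR : ∀ x y, R x y → φ x < φ y ∧ ψ x ≤ ψ y) (hS : ∀ x y, S x y → ψ x < ψ y ∧ φ y ≤ φ x)
    (hRl : ∀ x y z, R x z → R y z → x = y) (hSl : ∀ x y z, S x z → S y z → x = y) :
    Fintype.card V ≤ (Finset.univ.filter fun x => ∀ y, ¬ R x y).card *
      (Finset.univ.filter fun x => ∀ y, ¬ S x y).card := by
  choose r hr hr' using exists_reflTransGen_terminal (R := R) (φ := φ) fun x y h => (hR x y h).1
  choose s hs hs' using exists_reflTransGen_terminal (R := S) (φ := ψ) fun x y h => (hS x y h).1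
  rw [← Finset.card_product, ← Finset.card_univ]
  refine Finset.card_le_card_of_injOn (fun x => (r x, s x)) (fun x _ => by simp [hr', hs']) ?_
  have key : ∀ x y, Relation.ReflTransGen R x y → x = y ∨ (φ x < φ y ∧ ψ x ≤ ψ y) := by
    intro x y h
    induction h with
    | refl => exact Or.inl rfl
    | tail _ h ih =>
      right
      obtain ⟨h1, h2⟩ := hR _ _ h
      rcases ih with rfl | ⟨h3, h4⟩
      · exact ⟨h1, h2⟩
      · exact ⟨h3.trans h1, h4.trans h2⟩
  have key' : ∀ x y, Relation.ReflTransGen S x y → x = y ∨ (ψ x < ψ y ∧ φ y ≤ φ x) := by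
    intro x y h
    induction h with
    | refl => exact Or.inl rfl
    | tail _ h ih =>
      right
      obtain ⟨h1, h2⟩ := hS _ _ h
      rcases ih with rfl | ⟨h3, h4⟩
      · exact ⟨h1, h2⟩
      · exact ⟨h3.trans h1, h2.trans h4⟩
  intro x _ y _ hxy
  simp only [Prod.mk.injEq] at hxy
  have h1 := reflTransGen_or_of_common_terminal hRl (hr x) (hxy.1 ▸ hr y)
  have h2 := reflTransGen_or_of_common_terminal hSl (hs x) (hxy.2 ▸ hs y)
  by_contra hne
  have hne' : y ≠ x := fun h => hne h.symm
  have h1' := h1.imp (fun h => (key _ _ h).resolve_left hne) fun h => (key _ _ h).resolve_left hne'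
  have h2' := h2.imp (fun h => (key' _ _ h).resolve_left hne) fun h => (key' _ _ h).resolve_left hne'
  rcases h1' with ⟨a, b⟩ | ⟨a, b⟩ <;> rcases h2' with ⟨c, d⟩ | ⟨c, d⟩ <;> linarith

/-- Each edge is charged to its source in `R` or `S`, a nonterminal vertex charged at most once per
relation. -/
theorem ncard_edgeSet_le_two_mul_sub_sqrt {V : Type*} [Fintype V] {G : SimpleGraph V}
    {R S : V → V → Prop} {φ ψ : V → ℝ}
    (hR : ∀ x y, R x y → φ x < φ y ∧ ψ x ≤ ψ y) (hS : ∀ x y, S x y → ψ x < ψ y ∧ φ y ≤ φ x)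
    (hRl : ∀ x y z, R x z → R y z → x = y) (hSl : ∀ x y z, S x z → S y z → x = y)
    (hRr : ∀ x y z, R x y → R x z → y = z) (hSr : ∀ x y z, S x y → S x z → y = z)
    (hG : ∀ x y, G.Adj x y → R x y ∨ R y x ∨ S x y ∨ S y x) :
    (G.edgeSet.ncard : ℝ) ≤ 2 * Fintype.card V - 2 * √(Fintype.card V) := by
  classical
  have hn := card_le_mul_card_terminal hR hS hRl hSl
  set A := Finset.univ.filter fun x => ∀ y, ¬ R x y with hA
  set B := Finset.univ.filter fun x => ∀ y, ¬ S x y with hB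
  -- Terminal vertices get the junk successor `x`; only the images of `Aᶜ` and `Bᶜ` are used.
  have exR : ∀ x, ∃ y, (∃ z, R x z) → R x y := fun x => by
    by_cases h : ∃ z, R x z
    · exact ⟨h.choose, fun _ => h.choose_spec⟩
    · exact ⟨x, fun h' => absurd h' h⟩
  have exS : ∀ x, ∃ y, (∃ z, S x z) → S x y := fun x => by
    by_cases h : ∃ z, S x z
    · exact ⟨h.choose, fun _ => h.choose_spec⟩
    · exact ⟨x, fun h' => absurd h' h⟩
  choose r hr using exR
  choose s hs using exS
  have memR : ∀ x y, R x y → s(x, y) ∈ Aᶜ.image (fun x => s(x, r x)) := fun x y h => by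
    refine Finset.mem_image.2 ⟨x, by simpa [hA] using ⟨y, h⟩, ?_⟩
    rw [hRr x _ _ h (hr x ⟨y, h⟩)]
  have memS : ∀ x y, S x y → s(x, y) ∈ Bᶜ.image (fun x => s(x, s x)) := fun x y h => by
    refine Finset.mem_image.2 ⟨x, by simpa [hB] using ⟨y, h⟩, ?_⟩
    rw [hSr x _ _ h (hs x ⟨y, h⟩)]
  have hsub : G.edgeSet ⊆ ((Aᶜ.image (fun x => s(x, r x)) ∪ Bᶜ.image (fun x => s(x, s x)) :
      Finset (Sym2 V)) : Set (Sym2 V)) := by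
    intro e
    induction e using Sym2.ind with
    | _ x y =>
      intro h
      rw [Finset.coe_union, Set.mem_union, Finset.mem_coe, Finset.mem_coe]
      rcases hG x y h with h | h | h | h
      · exact Or.inl (memR x y h)
      · exact Or.inl (Sym2.eq_swap ▸ memR y x h)
      · exact Or.inr (memS x y h)
      · exact Or.inr (Sym2.eq_swap ▸ memS y x h)
  have h1 : G.edgeSet.ncard ≤ Aᶜ.card + Bᶜ.card := by
    refine (Set.ncard_le_ncard hsub (Finset.finite_toSet _)).trans ?_
    rw [Set.ncard_coe_finset]
    exact (Finset.card_union_le _ _).trans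
      (add_le_add Finset.card_image_le Finset.card_image_le)
  have h2 := Finset.card_add_card_compl A
  have h3 := Finset.card_add_card_compl B
  have h4 : (G.edgeSet.ncard : ℝ) + A.card + B.card ≤ 2 * Fintype.card V := by
    have : G.edgeSet.ncard + A.card + B.card ≤ 2 * Fintype.card V := by omega
    exact_mod_cast this
  -- The inequality of arithmetic and geometric means for the two terminal counts.
  have h5 : √(Fintype.card V : ℝ) ≤ ((A.card : ℝ) + B.card) / 2 := by
    rw [Real.sqrt_le_left (by positivity)]
    have : (Fintype.card V : ℝ) ≤ A.card * B.card := by exact_mod_cast hn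
    nlinarith [sq_nonneg ((A.card : ℝ) - B.card)]
  linarith

/-! ### At most four separated vectors -/

/-- Positively independent families in the plane have at most four members. -/
theorem encard_le_four_of_separated {X : Set Plane} (F : Plane → Plane →L[ℝ] ℝ)
    (hpos : ∀ x ∈ X, 0 < F x x) (hneg : ∀ x ∈ X, ∀ y ∈ X, y ≠ x → F x y ≤ 0) :
    X.encard ≤ 4 := by
  rcases X.eq_empty_or_nonempty with rfl | ⟨x, hx⟩
  · simp
  have hsymm : ∀ u v : Plane, detLeft u v = - detLeft v u := fun u v => by
    simp only [detLeft_apply]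
    ring
  -- Each open side of the line through `0` and `x` holds at most one member: of two, the one nearer
  -- in angle to `x` is a nonnegative combination of `x` and the other, against its own functional.
  have side : ∀ ε : ℝ, {y ∈ X | 0 < ε * detLeft y x}.Subsingleton := by
    intro ε
    have aux : ∀ y ∈ X, ∀ z ∈ X, 0 < ε * detLeft y x → 0 < ε * detLeft z x →
        0 ≤ ε * detLeft z y → y = z := by
      intro y hy z hz h1 h2 h3
      by_contra hne
      have hyx : x ≠ y := by
        rintro rfl
        rw [detLeft_apply] at h1
        ring_nf at h1
        exact lt_irrefl _ h1
      have hid : (ε * detLeft z x) • y = (ε * detLeft z y) • x + (ε * detLeft y x) • z := by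
        ext i
        fin_cases i <;> simp [detLeft_apply] <;> ring
      have h4 := congrArg (F y) hid
      simp only [map_add, map_smul, smul_eq_mul] at h4
      have h5 := mul_pos h2 (hpos y hy)
      have h6 := mul_nonpos_of_nonneg_of_nonpos h3 (hneg y hy x hx hyx)
      have h7 := mul_nonpos_of_nonneg_of_nonpos h1.le (hneg y hy z hz (Ne.symm hne))
      linarith
    rintro y ⟨hy, h1⟩ z ⟨hz, h2⟩
    rcases le_total 0 (ε * detLeft z y) with h | h
    · exact aux y hy z hz h1 h2 h
    · refine (aux z hz y hy h2 h1 ?_).symm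
      rw [hsymm]
      linarith
  -- Other members on the line are negative multiples of `x`, hence positive multiples of each
  -- other.
  have back : {y ∈ X | y ≠ x ∧ detLeft y x = 0}.Subsingleton := by
    rintro y ⟨hy, hyx, h1⟩ z ⟨hz, hzx, h2⟩
    by_contra hne
    have multiple : ∀ w, detLeft w x = 0 → F x x • w = F x w • x := by
      intro w hw
      have hx2 : ∀ v : Plane, v = v 0 • !₂[1, 0] + v 1 • !₂[0, 1] := fun v => by
        ext i
        fin_cases i <;> simp
      have hF : ∀ v, F x v = v 0 * F x !₂[1, 0] + v 1 * F x !₂[0, 1] := fun v => by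
        conv_lhs => rw [hx2 v]
        simp
      rw [detLeft_apply] at hw
      rw [hF w, hF x]
      ext i
      fin_cases i
      · simp
        linear_combination (-F x !₂[0, 1]) * hw
      · simp
        linear_combination (F x !₂[1, 0]) * hw
    have hy' := multiple y h1
    have hz' := multiple z h2
    have hxx := hpos x hx
    have e1 := congrArg (F y) hy'
    have e2 := congrArg (F y) hz'
    simp only [map_smul, smul_eq_mul] at e1 e2
    have p1 := mul_pos hxx (hpos y hy)
    have n1 := hneg x hx y hy hyx
    have n2 := hneg x hx z hz hzx
    have n3 := hneg y hy x hx (Ne.symm hyx)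
    have n4 := hneg y hy z hz (Ne.symm hne)
    have hyx0 : F y x < 0 := by
      rcases n3.lt_or_eq with h | h
      · exact h
      · rw [h, mul_zero] at e1
        linarith
    have hxz : F x z < 0 := by
      rcases n2.lt_or_eq with h | h
      · exact h
      · rw [h, zero_smul, smul_eq_zero] at hz'
        have hz0 : z = 0 := hz'.resolve_left hxx.ne'
        have := hpos z hz
        rw [hz0, map_zero] at this
        exact absurd this (lt_irrefl _)
    have p2 := mul_pos_of_neg_of_neg hxz hyx0
    have p3 := mul_nonpos_of_nonneg_of_nonpos hxx.le n4
    linarith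
  have hcover : X ⊆ ({x} ∪ {y ∈ X | 0 < 1 * detLeft y x}) ∪
      ({y ∈ X | 0 < (-1) * detLeft y x} ∪ {y ∈ X | y ≠ x ∧ detLeft y x = 0}) := by
    intro y hy
    by_cases hyx : y = x
    · exact Or.inl (Or.inl hyx)
    rcases lt_trichotomy (detLeft y x) 0 with h | h | h
    · exact Or.inr (Or.inl ⟨hy, by linarith⟩)
    · exact Or.inr (Or.inr ⟨hy, hyx, h⟩)
    · exact Or.inl (Or.inr ⟨hy, by linarith⟩)
  have one : ∀ {s : Set Plane}, s.Subsingleton → s.encard ≤ 1 := fun h =>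
    Set.encard_le_one_iff_subsingleton.2 h
  calc X.encard ≤ _ := Set.encard_le_encard hcover
    _ ≤ (1 + 1) + (1 + 1) := (Set.encard_union_le _ _).trans <| add_le_add
        ((Set.encard_union_le _ _).trans (add_le_add (one Set.subsingleton_singleton) (one (side 1))))
        ((Set.encard_union_le _ _).trans (add_le_add (one (side (-1))) (one back)))
    _ = 4 := by norm_num

/-! ### Counting edges of a grid filled row by row -/

/-- Rows have length `k`, and `k ∣ s + 1` marks row ends. There are `n - 1 - (n - 1) / k` edges
within rows and `n - k` between rows; `2 ≤ k` keeps the two kinds distinct. -/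
theorem le_ncard_edgeSet_of_grid {V : Type*} [Finite V] {n k m : ℕ} (hk : 2 ≤ k)
    {G : SimpleGraph V} {P : Fin n → V} (hP : Function.Injective P)
    (hrow : ∀ s t : Fin n, (t : ℕ) = s + 1 → ¬ k ∣ (s : ℕ) + 1 → G.Adj (P s) (P t))
    (hcol : ∀ s t : Fin n, (t : ℕ) = s + k → G.Adj (P s) (P t))
    (hm : m + k + ((n - 1) / k + 1) ≤ 2 * n) (hkn : k ≤ n) : m ≤ G.edgeSet.ncard := by
  classical
  let A : Finset (Fin (n - 1)) := Finset.univ.filter fun s => ¬ k ∣ (s : ℕ) + 1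
  let F : (A ⊕ Fin (n - k)) → G.edgeSet := Sum.elim
    (fun s => ⟨s(P ⟨s.1, by omega⟩, P ⟨s.1 + 1, by omega⟩),
      hrow _ _ rfl (Finset.mem_filter.1 s.2).2⟩)
    (fun s => ⟨s(P ⟨s, by omega⟩, P ⟨s + k, by omega⟩), hcol _ _ rfl⟩)
  have hF : Function.Injective F := by
    rintro (s | s) (t | t) h <;> replace h := congrArg Subtype.val h <;>
      simp only [F, Sum.elim_inl, Sum.elim_inr, Sym2.eq_iff, hP.eq_iff, Fin.mk.injEq] at h
    · congr 1
      ext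
      omega
    · omega
    · omega
    · congr 1
      ext
      omega
  have hcard := Nat.card_le_card_of_injective F hF
  rw [Nat.card_sum, Nat.card_eq_fintype_card, Fintype.card_coe, Nat.card_eq_fintype_card,
    Fintype.card_fin, Nat.card_coe_set_eq] at hcard
  have hA : A.card + (n - 1) / k = n - 1 := by
    have h1 := Finset.card_filter_add_card_filter_not (s := Finset.range (n - 1))
      (fun e => k ∣ e + 1)
    rw [Nat.card_multiples, Finset.card_range] at h1
    have h2 : A.card = ((Finset.range (n - 1)).filter fun e => ¬ k ∣ e + 1).card := by
      rw [← Finset.card_map Fin.valEmbedding]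
      congr 1
      ext e
      simp only [A, Finset.mem_map, Finset.mem_filter, Finset.mem_univ, true_and,
        Fin.valEmbedding_apply, Finset.mem_range]
      constructor
      · rintro ⟨s, hs, rfl⟩
        exact ⟨s.2, hs⟩
      · rintro ⟨h, h'⟩
        exact ⟨⟨e, h⟩, h', rfl⟩
    omega
  omega

/-- The grid has row length `r + 1 = ⌈√n⌉` and `q + 1` rows. Failure would give `4n ≤ (r + q + 1)²`,
which contradicts `n > r (r + 1)` if `q = r` and `n > r²` if `q < r`. -/
theorem floor_add_grid_dims_le {n : ℕ} (hn : 2 ≤ n) :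
    ⌊2 * (n : ℝ) - 2 * √(n : ℝ)⌋₊ + (Nat.sqrt (n - 1) + 1) +
      ((n - 1) / (Nat.sqrt (n - 1) + 1) + 1) ≤ 2 * n := by
  set r := Nat.sqrt (n - 1)
  set q := (n - 1) / (r + 1)
  have h1 : r * r ≤ n - 1 := Nat.sqrt_le (n - 1)
  have h2 : n - 1 < (r + 1) * (r + 1) := Nat.lt_succ_sqrt (n - 1)
  have h3 : q * (r + 1) ≤ n - 1 := Nat.div_mul_le_self _ _
  have hqr : q ≤ r := Nat.lt_succ_iff.1 ((Nat.div_lt_iff_lt_mul (Nat.succ_pos r)).2 h2)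
  have hn1 : (1 : ℝ) ≤ n := by exact_mod_cast (by omega : 1 ≤ n)
  have hs := Real.sq_sqrt (show (0 : ℝ) ≤ n by positivity)
  have hs0 := Real.sqrt_nonneg (n : ℝ)
  have hfl := Nat.floor_le (show (0 : ℝ) ≤ 2 * (n : ℝ) - 2 * √(n : ℝ) by nlinarith)
  by_contra! hcon
  have h4 : (2 * n : ℝ) + 1 ≤ ⌊2 * (n : ℝ) - 2 * √(n : ℝ)⌋₊ + (r + 1) + (q + 1) := by
    exact_mod_cast hcon
  have h5 : 2 * √(n : ℝ) ≤ r + q + 1 := by linarith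
  have h6 : 4 * n ≤ (r + q + 1) ^ 2 := by
    have : (4 * n : ℝ) ≤ (r + q + 1) ^ 2 := by nlinarith
    exact_mod_cast this
  obtain ⟨d, hd⟩ := Nat.exists_eq_add_of_le hqr
  have h7 : q * (r + 1) + 1 ≤ n := by omega
  have h8 : r * r + 1 ≤ n := by omega
  rcases Nat.eq_zero_or_pos d with h | h
  · subst h
    rw [hd] at h6 h7
    nlinarith
  · have : q + 1 ≤ r := by omega
    nlinarith

/-! ### Totally separable lattice packings -/

theorem Separates.nonOverlapping {f : Plane →L[ℝ] ℝ} (hf : f ≠ 0) {c : ℝ} {A B : Set Plane}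
    (h : Separates f c A B) : NonOverlapping A B :=
  Set.disjoint_left.2 fun _ hA hB =>
    lt_asymm (lt_of_mem_interior hf h.1 hA) (gt_of_mem_interior hf h.2 hB)

theorem forall_mem_translateBy {K : Set Plane} {x : Plane} {P : Plane → Prop} :
    (∀ p ∈ translateBy x K, P p) ↔ ∀ p ∈ K, P (x + p) :=
  Set.forall_mem_image

theorem separates_of_int_valued {K X : Set Plane} {f : Plane →L[ℝ] ℝ} (hf : f ≠ 0) {m : ℝ}
    (hm : ∀ p ∈ K, m ≤ f p ∧ f p ≤ m + 1) (hX : ∀ z ∈ X, ∃ i : ℤ, f z = i) {x y : Plane}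
    (hx : x ∈ X) (hy : y ∈ X) (hxy : f x < f y) :
    ∃ c : ℝ, Separates f c (translateBy x K) (translateBy y K) ∧
      ∀ z ∈ X, Disjoint {p | f p = c} (interior (translateBy z K)) := by
  obtain ⟨i, hi⟩ := hX x hx
  obtain ⟨j, hj⟩ := hX y hy
  have hij : (i : ℝ) + 1 ≤ j := by
    rw [hi, hj] at hxy
    exact_mod_cast Int.add_one_le_iff.2 (by exact_mod_cast hxy)
  -- Members lie in strips `m + i ≤ f ≤ m + i + 1` with `i` an integer; the line is the lower edge
  -- of the strip of `y`.
  refine ⟨m + j, ⟨forall_mem_translateBy.2 fun p hp => ?_,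
    forall_mem_translateBy.2 fun p hp => ?_⟩, fun z hz => ?_⟩
  · have := (hm p hp).2
    rw [map_add]
    linarith
  · have := (hm p hp).1
    rw [map_add]
    linarith
  · obtain ⟨l, hl⟩ := hX z hz
    refine Set.disjoint_left.2 fun p hp hpz => ?_
    have hp : f p = m + j := hp
    rcases le_or_gt j l with h | h
    · have h' : (j : ℝ) ≤ l := by exact_mod_cast h
      have := gt_of_mem_interior hf (c := m + j) (forall_mem_translateBy.2 fun q hq => by
        have := (hm q hq).1
        rw [map_add]
        linarith) hpz
      linarith
    · have h' : (l : ℝ) + 1 ≤ j := by exact_mod_cast h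
      have := lt_of_mem_interior hf (c := m + j) (forall_mem_translateBy.2 fun q hq => by
        have := (hm q hq).2
        rw [map_add]
        linarith) hpz
      linarith

theorem separates_of_int_valued_of_ne {K X : Set Plane} {f : Plane →L[ℝ] ℝ} (hf : f ≠ 0) {m : ℝ}
    (hm : ∀ p ∈ K, m ≤ f p ∧ f p ≤ m + 1) (hX : ∀ z ∈ X, ∃ i : ℤ, f z = i) {x y : Plane}
    (hx : x ∈ X) (hy : y ∈ X) (hxy : f x ≠ f y) :
    ∃ f : Plane →L[ℝ] ℝ, f ≠ 0 ∧ ∃ c : ℝ, Separates f c (translateBy x K) (translateBy y K) ∧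
      ∀ z ∈ X, Disjoint {p | f p = c} (interior (translateBy z K)) := by
  rcases hxy.lt_or_gt with h | h
  · exact ⟨f, hf, separates_of_int_valued hf hm hX hx hy h⟩
  -- On `K`, `-f` ranges within `[-m - 1, -m]`.
  · refine ⟨-f, neg_ne_zero.2 hf, separates_of_int_valued (neg_ne_zero.2 hf) (m := -m - 1)
      (fun p hp => ?_) (fun z hz => ?_) hx hy (by simpa using h)⟩
    · have := hm p hp
      rw [neg_apply]
      constructor <;> linarith
    · obtain ⟨i, hi⟩ := hX z hz
      exact ⟨-i, by simp [hi]⟩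

namespace IsAuerbachBasis

variable {K : Set Plane} {a b : Plane} {f g : Plane →L[ℝ] ℝ}

theorem exists_range (h : IsAuerbachBasis K a b f g) : ∃ m, ∀ p ∈ K, m ≤ f p ∧ f p ≤ m + 1 := by
  obtain ⟨p, hp, q, hq, he⟩ := h.left_mem
  have h1 := h.left_left
  rw [he, map_sub] at h1
  refine ⟨f q, fun r hr => ?_⟩
  have h2 := h.left_le r hr q hq
  have h3 := h.left_le p hp r hr
  constructor <;> linarith

/-- Any subset of the lattice of an Auerbach basis yields a totally separable packing. -/
theorem isTotallySeparablePacking (h : IsAuerbachBasis K a b f g) {X : Set Plane}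
    (hX : ∀ z ∈ X, ∃ i j : ℤ, z = (i : ℝ) • a + (j : ℝ) • b) : IsTotallySeparablePacking K X := by
  have hf : ∀ z ∈ X, ∃ i : ℤ, f z = i := fun z hz => by
    obtain ⟨i, j, rfl⟩ := hX z hz
    exact ⟨i, by simp [h.left_left, h.left_right]⟩
  have hg : ∀ z ∈ X, ∃ i : ℤ, g z = i := fun z hz => by
    obtain ⟨i, j, rfl⟩ := hX z hz
    exact ⟨j, by simp [h.right_left, h.right_right]⟩
  have hsep : X.Pairwise fun x y => ∃ f : Plane →L[ℝ] ℝ, f ≠ 0 ∧ ∃ c : ℝ,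
      Separates f c (translateBy x K) (translateBy y K) ∧
        ∀ z ∈ X, Disjoint {p | f p = c} (interior (translateBy z K)) := by
    intro x hx y hy hxy
    by_cases hfxy : f x = f y
    · obtain ⟨m, hm⟩ := h.rotate.exists_range
      refine separates_of_int_valued_of_ne h.right_supports.ne_zero hm hg hx hy fun hgxy => hxy ?_
      rw [h.decomp x, h.decomp y, hfxy, hgxy]
    · obtain ⟨m, hm⟩ := h.exists_range
      exact separates_of_int_valued_of_ne h.left_supports.ne_zero hm hf hx hy hfxy
  refine ⟨fun x hx y hy hxy => ?_, hsep⟩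
  obtain ⟨F, hF, c, hc, -⟩ := hsep hx hy hxy
  exact hc.nonOverlapping hF

theorem touches_of_sub_eq {X : Set Plane} (hX : IsTotallySeparablePacking K X) {x y : Plane}
    (hx : x ∈ X) (hy : y ∈ X) (hxy : x ≠ y) (h : ∃ p ∈ K, ∃ q ∈ K, y - x = p - q) :
    Touches (translateBy x K) (translateBy y K) := by
  obtain ⟨p, hp, q, hq, he⟩ := h
  refine ⟨hX.1 hx hy hxy, x + p, mem_translateBy_add x hp, q, hq, ?_⟩
  rw [sub_eq_sub_iff_add_eq_add] at he
  simp only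
  rw [he, add_comm]

end IsAuerbachBasis

/-! ### The separable Hadwiger number -/

theorem four_mem_separableHadwigerValues {K : Set Plane} (hK : IsConvexDomain K) :
    4 ∈ separableHadwigerValues K := by
  obtain ⟨a, b, f, g, h⟩ := exists_isAuerbachBasis hK
  have hX : IsTotallySeparablePacking K (insert 0 {a, b, -a, -b}) := by
    refine h.isTotallySeparablePacking ?_
    rintro z (rfl | rfl | rfl | rfl | rfl)
    · exact ⟨0, 0, by simp⟩
    · exact ⟨1, 0, by simp⟩
    · exact ⟨0, 1, by simp⟩
    · exact ⟨-1, 0, by simp⟩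
    · exact ⟨0, -1, by simp⟩
  have ne : ∀ {u v : Plane} (F : Plane →L[ℝ] ℝ), F u ≠ F v → u ≠ v := fun F h e => h (e ▸ rfl)
  refine ⟨{a, b, -a, -b}, fun x hx => ?_, hX, ?_⟩
  · have htouch : x ≠ 0 → (∃ p ∈ K, ∃ q ∈ K, 0 - x = p - q) → Touches (translateBy x K) K :=
      fun h0 hm => by
        have := IsAuerbachBasis.touches_of_sub_eq hX (Set.mem_insert_of_mem _ hx)
          (Set.mem_insert _ _) h0 hm
        rwa [translateBy_zero] at this
    rcases hx with rfl | rfl | rfl | rfl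
    · refine htouch (ne f (by simp [h.left_left])) ?_
      rw [zero_sub]
      exact h.rotate.right_mem
    · refine htouch (ne g (by simp [h.right_right])) ?_
      rw [zero_sub]
      exact h.rotate.rotate.right_mem
    · refine htouch (ne f (by simp [h.left_left])) ?_
      rw [zero_sub, neg_neg]
      exact h.left_mem
    · refine htouch (ne g (by simp [h.right_right])) ?_
      rw [zero_sub, neg_neg]
      exact h.right_mem
  · have h1 : a ∉ ({b, -a, -b} : Set Plane) := by
      rintro (e | e | e) <;> have := congrArg f e <;>
        simp [h.left_left, h.left_right] at this
      linarith
    have h2 : b ∉ ({-a, -b} : Set Plane) := by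
      rintro (e | e) <;> have := congrArg g e <;>
        simp [h.right_left, h.right_right] at this
      linarith
    have h3 : -a ∉ ({-b} : Set Plane) := by
      rintro e
      have := congrArg f e
      simp [h.left_left, h.left_right] at this
    rw [Set.encard_insert_of_notMem h1, Set.encard_insert_of_notMem h2,
      Set.encard_insert_of_notMem h3, Set.encard_singleton]
    norm_num

theorem isGreatest_separableHadwigerValues {K : Set Plane} (hK : IsConvexDomain K)
    (hs : IsSmoothDomain K) : IsGreatest (separableHadwigerValues K) 4 := by
  refine ⟨four_mem_separableHadwigerValues hK, ?_⟩
  rintro _ ⟨X, htouch, hX, rfl⟩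
  have ht : ∀ x ∈ X, Touches (translateBy 0 K) (translateBy x K) := fun x hx => by
    rw [translateBy_zero]
    exact (htouch x hx).symm
  have hex : ∀ x, ∃ F : Plane →L[ℝ] ℝ, x ∈ X →
      0 < F x ∧ ∀ y ∈ X, y ≠ x → F y ≤ 0 := by
    intro x
    by_cases hx : x ∈ X
    · obtain ⟨F, hF, hneg⟩ := hX.exists_contact_functional hK hs (Set.mem_insert _ _)
        (Set.mem_insert_of_mem _ hx) (ht x hx)
      refine ⟨F, fun _ => ⟨by simpa using hF.pos hK, fun y hy hyx => ?_⟩⟩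
      simpa using hneg y (Set.mem_insert_of_mem _ hy) hyx (ht y hy)
    · exact ⟨0, fun h => absurd h hx⟩
  choose F hF using hex
  exact encard_le_four_of_separated F (fun x hx => (hF x hx).1) fun x hx => (hF x hx).2

/-! ### Contacts in a quadrant -/

namespace IsAuerbachBasis

variable {K : Set Plane} {a b : Plane} {f g : Plane →L[ℝ] ℝ}

/-- By strict convexity `g` has a unique maximizer and a unique minimizer on `K`, so their
difference is its only maximizer on `K - K`. -/
theorem eq_right_of_right_eq_one (h : IsAuerbachBasis K a b f g) (hc : StrictConvex ℝ K)
    {u : Plane} (hu : ∃ p ∈ K, ∃ q ∈ K, u = p - q) (hgu : g u = 1) : u = b := by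
  have hg := h.right_supports.ne_zero
  have huniq : ∀ G : Plane →L[ℝ] ℝ, G ≠ 0 → ∀ p ∈ K, ∀ p' ∈ K, (∀ r ∈ K, G r ≤ G p) →
      G p' = G p → p = p' := by
    intro G hG p hp p' hp' hmax he
    by_contra hne
    have hint := hc hp hp' hne (a := 1 / 2) (b := 1 / 2) (by norm_num) (by norm_num) (by norm_num)
    have := lt_of_mem_interior hG hmax hint
    simp only [map_add, map_smul, smul_eq_mul] at this
    linarith
  obtain ⟨p, hp, q, hq, rfl⟩ := hu
  obtain ⟨p', hp', q', hq', hb⟩ := h.right_mem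
  have hgb := h.right_right
  rw [hb, map_sub] at hgb
  rw [map_sub] at hgu
  have l1 := h.right_le p hp q' hq'
  have l2 := h.right_le p' hp' q hq
  have e1 : p = p' := huniq g hg p hp p' hp' (fun r hr => by
    have := h.right_le r hr q hq
    linarith) (by linarith)
  have e2 : q = q' := huniq (-g) (neg_ne_zero.2 hg) q hq q' hq' (fun r hr => by
    have := h.right_le p hp r hr
    simp only [neg_apply]
    linarith) (by simp only [neg_apply]; linarith)
  rw [hb, e1, e2]

/-- A functional supporting the difference body in the half-open first quadrant is positive on that
quadrant. -/
theorem supports_pos (h : IsAuerbachBasis K a b f g) (hK : IsConvexDomain K)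
    (hs : IsSmoothDomain K) (hc : StrictConvex ℝ K) {F : Plane →L[ℝ] ℝ} {u v : Plane}
    (hF : SupportsDifferenceAt K F u) (hu1 : 0 < f u) (hu2 : 0 ≤ g u) (hv1 : 0 < f v)
    (hv2 : 0 ≤ g v) : 0 < F v := by
  have hval : ∀ w, F w = f w * F a + g w * F b := fun w => by
    conv_lhs => rw [h.decomp w]
    simp
  have hFu := hF.pos hK
  have hle : ∀ w, (∃ p ∈ K, ∃ q ∈ K, w = p - q) → F w ≤ F u ∧ f w ≤ 1 ∧ g w ≤ 1 := by
    rintro w ⟨p, hp, q, hq, rfl⟩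
    simp only [map_sub F p q, map_sub f p q, map_sub g p q]
    exact ⟨hF.le p hp q hq, h.left_le p hp q hq, h.right_le p hp q hq⟩
  have ha := (hle a h.left_mem).1
  have hb := (hle b h.right_mem).1
  obtain ⟨-, hfu, hgu⟩ := hle u hF.mem
  have hu := hval u
  have hFb : 0 ≤ F b := by
    by_contra! hneg
    have h1 : g u * F b ≤ 0 := mul_nonpos_of_nonneg_of_nonpos hu2 hneg.le
    have h2 : 0 < F a := by
      by_contra! h0
      have := mul_nonpos_of_nonneg_of_nonpos hu1.le h0
      linarith
    have h3 : F a = F u := by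
      nlinarith
    have h4 : f u = 1 := by
      rw [← h3] at hu
      nlinarith
    have h5 : g u = 0 := by
      rw [h4, ← h3] at hu
      have : g u * F b = 0 := by linarith
      exact (mul_eq_zero.1 this).resolve_right hneg.ne
    have h6 : u = a := by
      rw [h.decomp u, h4, h5]
      simp
    rw [h6] at hF
    have h7 := hF.proportional hs h.left_supports b
    rw [h.left_left, h.left_right] at h7
    linarith
  -- If `F a ≤ 0`, maximality forces `g u = 1`, so `u = b` by strict convexity, against `0 < f u`.
  have hFa : 0 < F a := by
    by_contra! hneg
    have h1 : f u * F a ≤ 0 := mul_nonpos_of_nonneg_of_nonpos hu1.le hneg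
    have h2 : 0 < F b := by
      by_contra! h0
      have := mul_nonpos_of_nonneg_of_nonpos hu2 h0
      linarith
    have h3 : F b = F u := by
      nlinarith
    have h4 : g u = 1 := by
      rw [← h3] at hu
      nlinarith
    have h6 := h.eq_right_of_right_eq_one hc hF.mem h4
    rw [h6, h.left_right] at hu1
    exact lt_irrefl _ hu1
  rw [hval v]
  have := mul_pos hv1 hFa
  have := mul_nonneg hv2 hFb
  linarith

theorem eq_of_touches_of_quadrant (h : IsAuerbachBasis K a b f g) (hK : IsConvexDomain K)
    (hs : IsSmoothDomain K) (hc : StrictConvex ℝ K) {X : Set Plane}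
    (hX : IsTotallySeparablePacking K X) {x y z : Plane} (hx : x ∈ X) (hy : y ∈ X) (hz : z ∈ X)
    (hxy : Touches (translateBy x K) (translateBy y K))
    (hxz : Touches (translateBy x K) (translateBy z K))
    (hy1 : 0 < f (y - x)) (hy2 : 0 ≤ g (y - x)) (hz1 : 0 < f (z - x)) (hz2 : 0 ≤ g (z - x)) :
    y = z := by
  by_contra hne
  obtain ⟨F, hF, hneg⟩ := hX.exists_contact_functional hK hs hx hy hxy
  exact absurd (h.supports_pos hK hs hc hF hy1 hy2 hz1 hz2)
    (not_lt.2 (hneg z hz (Ne.symm hne) hxz))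

end IsAuerbachBasis

/-- The members `x`, `y` touch, and `y - x` is in the half-open first quadrant of the dual basis. -/
def QuadrantContact (K : Set Plane) (f g : Plane →L[ℝ] ℝ) (x y : Plane) : Prop :=
  Touches (translateBy x K) (translateBy y K) ∧ 0 < f (y - x) ∧ 0 ≤ g (y - x)

theorem QuadrantContact.right_unique {K X : Set Plane} {a b : Plane} {f g : Plane →L[ℝ] ℝ}
    (hK : IsConvexDomain K) (hs : IsSmoothDomain K) (hc : StrictConvex ℝ K)
    (hX : IsTotallySeparablePacking K X) (h : IsAuerbachBasis K a b f g) (x y z : X)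
    (h1 : QuadrantContact K f g x y) (h2 : QuadrantContact K f g x z) : y = z :=
  Subtype.ext <| h.eq_of_touches_of_quadrant hK hs hc hX x.2 y.2 z.2 h1.1 h2.1 h1.2.1 h1.2.2
    h2.2.1 h2.2.2

/-- For the negated basis, predecessors become successors. -/
theorem QuadrantContact.left_unique {K X : Set Plane} {a b : Plane} {f g : Plane →L[ℝ] ℝ}
    (hK : IsConvexDomain K) (hs : IsSmoothDomain K) (hc : StrictConvex ℝ K)
    (hX : IsTotallySeparablePacking K X) (h : IsAuerbachBasis K a b f g) (x y z : X)
    (h1 : QuadrantContact K f g x z) (h2 : QuadrantContact K f g y z) : x = y := by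
  have hneg : ∀ (F : Plane →L[ℝ] ℝ) (u v : Plane), (-F) (u - v) = F (v - u) := fun F u v => by
    simp
  exact right_unique hK hs hc hX h.rotate.rotate z x y
    ⟨h1.1.symm, by rw [hneg]; exact h1.2.1, by rw [hneg]; exact h1.2.2⟩
    ⟨h2.1.symm, by rw [hneg]; exact h2.2.1, by rw [hneg]; exact h2.2.2⟩

/-! ### The maximum separable contact number -/

theorem ncard_contactGraph_le {K : Set Plane} (hK : IsConvexDomain K) (hs : IsSmoothDomain K)
    (hc : StrictConvex ℝ K) {X : Finset Plane} (hX : IsTotallySeparablePacking K (X : Set Plane)) :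
    (contactGraph K (X : Set Plane)).edgeSet.ncard ≤
      ⌊2 * (X.card : ℝ) - 2 * √(X.card : ℝ)⌋₊ := by
  obtain ⟨a, b, f, g, h⟩ := exists_isAuerbachBasis hK
  refine Nat.le_floor ?_
  have := ncard_edgeSet_le_two_mul_sub_sqrt (V := (X : Set Plane))
    (G := contactGraph K (X : Set Plane))
    (R := fun x y => QuadrantContact K f g x y) (S := fun x y => QuadrantContact K g (-f) x y)
    (φ := fun x => f x) (ψ := fun x => g x)
    (fun x y h => by
      obtain ⟨-, h1, h2⟩ := h
      rw [map_sub] at h1 h2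
      exact ⟨by linarith, by linarith⟩)
    (fun x y h => by
      obtain ⟨-, h1, h2⟩ := h
      rw [neg_apply, map_sub] at h2
      rw [map_sub] at h1
      exact ⟨by linarith, by linarith⟩)
    (QuadrantContact.left_unique hK hs hc hX h)
    (QuadrantContact.left_unique hK hs hc hX h.rotate)
    (QuadrantContact.right_unique hK hs hc hX h)
    (QuadrantContact.right_unique hK hs hc hX h.rotate)
    (fun x y hxy => by
      obtain ⟨hne, ht⟩ := hxy
      have ht' := ht.symm
      simp only [QuadrantContact, neg_apply, map_sub, ht, ht', true_and]
      -- The eight nonzero sign patterns fall into the four half-open quadrants; the zero pattern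
      -- would give `x = y`.
      rcases lt_trichotomy (f x) (f y) with hf | hf | hf <;>
        rcases lt_trichotomy (g x) (g y) with hg | hg | hg
      · exact Or.inl ⟨by linarith, by linarith⟩
      · exact Or.inl ⟨by linarith, by linarith⟩
      · exact Or.inr (Or.inr (Or.inr ⟨by linarith, by linarith⟩))
      · exact Or.inr (Or.inr (Or.inl ⟨by linarith, by linarith⟩))
      · exact absurd (Subtype.ext (by rw [h.decomp x, h.decomp y, hf, hg])) hne
      · exact Or.inr (Or.inr (Or.inr ⟨by linarith, by linarith⟩))
      · exact Or.inr (Or.inr (Or.inl ⟨by linarith, by linarith⟩))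
      · exact Or.inr (Or.inl ⟨by linarith, by linarith⟩)
      · exact Or.inr (Or.inl ⟨by linarith, by linarith⟩))
  simpa using this

theorem exists_packing_floor_le {K : Set Plane} (hK : IsConvexDomain K) {n : ℕ} (hn : 2 ≤ n) :
    ∃ X : Finset Plane, X.card = n ∧ IsTotallySeparablePacking K (X : Set Plane) ∧
      ⌊2 * (n : ℝ) - 2 * √(n : ℝ)⌋₊ ≤ (contactGraph K (X : Set Plane)).edgeSet.ncard := by
  classical
  obtain ⟨a, b, f, g, h⟩ := exists_isAuerbachBasis hK
  -- This is `⌈√n⌉`; subtracting 1 first gives the exact root at perfect squares.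
  set k := Nat.sqrt (n - 1) + 1 with hk
  have hk2 : 2 ≤ k := by
    have : 0 < Nat.sqrt (n - 1) := Nat.sqrt_pos.2 (by omega)
    omega
  have hkn : k ≤ n := by
    have := Nat.sqrt_le_self (n - 1)
    omega
  let Q : Fin n → Plane := fun t => ((t / k : ℕ) : ℝ) • a + ((t % k : ℕ) : ℝ) • b
  have hfQ : ∀ t, f (Q t) = ((t / k : ℕ) : ℝ) := fun t => by
    simp only [Q, map_add, map_smul, h.left_left, h.left_right, smul_eq_mul]
    ring
  have hgQ : ∀ t, g (Q t) = ((t % k : ℕ) : ℝ) := fun t => by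
    simp only [Q, map_add, map_smul, h.right_left, h.right_right, smul_eq_mul]
    ring
  have hQ : Function.Injective Q := by
    intro s t hst
    have h1 := congrArg f hst
    have h2 := congrArg g hst
    rw [hfQ, hfQ, Nat.cast_inj] at h1
    rw [hgQ, hgQ, Nat.cast_inj] at h2
    ext
    rw [← Nat.div_add_mod s k, ← Nat.div_add_mod t k, h1, h2]
  let X : Finset Plane := Finset.univ.image Q
  have hmem : ∀ t, Q t ∈ (X : Set Plane) := fun t => by simp [X]
  have hX : IsTotallySeparablePacking K (X : Set Plane) := by
    refine h.isTotallySeparablePacking fun z hz => ?_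
    simp only [X, Finset.coe_image, Finset.coe_univ, Set.image_univ, Set.mem_range] at hz
    obtain ⟨t, rfl⟩ := hz
    exact ⟨(t / k : ℕ), (t % k : ℕ), by simp only [Q, Int.cast_natCast]⟩
  refine ⟨X, by simp [X, Finset.card_image_of_injective _ hQ], hX, ?_⟩
  have hadj : ∀ s t, (s : Fin n) ≠ t → (∃ p ∈ K, ∃ q ∈ K, Q t - Q s = p - q) →
      (contactGraph K (X : Set Plane)).Adj ⟨Q s, hmem s⟩ ⟨Q t, hmem t⟩ := fun s t hst hm =>
    ⟨fun e => hst (hQ (congrArg Subtype.val e)),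
      IsAuerbachBasis.touches_of_sub_eq hX (hmem s) (hmem t) (hQ.ne hst) hm⟩
  refine le_ncard_edgeSet_of_grid (P := fun t => (⟨Q t, hmem t⟩ : (X : Set Plane))) hk2
    (fun s t hst => hQ (congrArg Subtype.val hst)) ?_ ?_ (floor_add_grid_dims_le hn) hkn
  · intro s t hst hdiv
    refine hadj s t (fun e => by rw [e] at hst; omega) ?_
    have h1 : (t : ℕ) / k = s / k := by
      rw [hst, Nat.succ_div, if_neg hdiv, add_zero]
    have h2 : (t : ℕ) % k = s % k + 1 := by
      have e1 := Nat.div_add_mod (t : ℕ) k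
      have e2 := Nat.div_add_mod (s : ℕ) k
      rw [h1] at e1
      omega
    have : Q t - Q s = b := by
      simp only [Q, h1, h2]
      push_cast
      module
    rw [this]
    exact h.right_mem
  · intro s t hst
    refine hadj s t (fun e => by rw [e] at hst; omega) ?_
    have h1 : (t : ℕ) / k = s / k + 1 := by
      rw [hst, Nat.add_div_right _ (by omega)]
    have h2 : (t : ℕ) % k = s % k := by
      rw [hst, Nat.add_mod_right]
    have : Q t - Q s = a := by
      simp only [Q, h1, h2]
      push_cast
      module
    rw [this]
    exact h.left_mem

theorem theorem1 :
    (∀ K : Set Plane, IsConvexDomain K → IsSmoothDomain K →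
      IsGreatest (separableHadwigerValues K) 4) ∧
    (∀ K : Set Plane, IsConvexDomain K → IsSmoothDomain K → StrictConvex ℝ K →
      ∀ n : ℕ, 2 ≤ n →
        IsGreatest (separableContactValues K n) ⌊2 * (n : ℝ) - 2 * Real.sqrt (n : ℝ)⌋₊) := by
  refine ⟨fun K hK hs => isGreatest_separableHadwigerValues hK hs, fun K hK hs hc n hn => ⟨?_, ?_⟩⟩
  · obtain ⟨X, hcard, hX, hle⟩ := exists_packing_floor_le hK hn
    refine ⟨X, hcard, hX, le_antisymm ?_ hle⟩
    rw [← hcard]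
    exact ncard_contactGraph_le hK hs hc hX
  · rintro _ ⟨X, rfl, hX, rfl⟩
    exact ncard_contactGraph_le hK hs hc hX
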